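/- Let $\mathbb F_q$ be a finite field, let $K_1,\dots,K_n\subseteq\mathbb F_q$ be non-empty subsets with $d_i:=|K_i|$ and $d_1\le d_2\le\cdots\le d_n$, let $\mathcal X:=K_1\times\cdots\times K_n$ and $m:=|\mathcal X|=\prod_{i=1}^n d_i$, and let $\Psi:\mathbb F_q[X_1,\dots,X_n]\to\mathbb F_q^m$ be the map that evaluates a polynomial at the $m$ points of $\mathcal X$. Let $s\in\{1,\dots,n\}$, let $\delta$ be an integer with $2\le\delta\le d_s$, and put $r:=d_s-\delta+1$. For an integer $d\ge 0$ let $\mathcal C_{\mathcal X}(d)$ (the affine cartesian code) be the image under $\Psi$ of the space of polynomials of total degree at most $d$, and let $\mathcal D^{(\delta,s)}_{\mathcal X}(d)$ (the quasi affine cartesian code) be the image under $\Psi$ of the space consisting of $0$ and all polynomials $f$ of total degree at most $d$ with $\deg_{X_s}f<d_s-\delta+1$. Write $W^{(1)}(C)$ for the minimum (Hamming) distance of a code $C$. Let $d=\sum_{i=1}^k(d_i-1)+\ell$ with integers $0\le k<n$ and $0<\ell\le d_{k+1}-1$, and let $\kappa:=\dim_{\mathbb F_q}\mathcal D^{(\delta,s)}_{\mathcal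 X}(d)$. Then $$W^{(1)}(\mathcal C_{\mathcal X}(d))\;\le\;W^{(1)}(\mathcal D^{(\delta,s)}_{\mathcal X}(d))\;\le\;m-\kappa-\left(\left\lceil\frac{\kappa}{r}\right\rceil-1\right)(\delta-1)+1 .$$ Moreover, if (i) $k+2\le n$ and $d_{k+2}\le d_s$, or (ii) $d_s\le d_{k+1}$ and $0\le d_s-(d_{k+1}-\ell)<r$, then $W^{(1)}(\mathcal D^{(\delta,s)}_{\mathcal X}(d))=W^{(1)}(\mathcal C_{\mathcal X}(d))$. -/

import Mathlib

/-- The minimum (Hamming) distance of a linear code: the least Hamming distance between two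
distinct codewords. (For the zero code there are no such pairs and the value is `0` by
convention.) -/
noncomputable def minDistance {F ι : Type*} [Field F] [DecidableEq F] [Fintype ι]
    (C : Submodule F (ι → F)) : ℕ :=
  sInf {w : ℕ | ∃ x ∈ C, ∃ y ∈ C, x ≠ y ∧ hammingDist x y = w}

/-- Evaluation of polynomials at all the points of `K₁ × ⋯ × Kₙ`; the coordinates of the target
are indexed by the points themselves. -/
noncomputable def evalPoints {F : Type*} [Field F] {n : ℕ} (K : Fin n → Finset F) :
    MvPolynomial (Fin n) F →ₗ[F] (↥(Fintype.piFinset K) → F) :=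
  LinearMap.pi fun α => (MvPolynomial.aeval (α : Fin n → F)).toLinearMap

/-- The affine cartesian code of order `d`: the image under evaluation of all polynomials of
total degree at most `d`. -/
noncomputable def affineCartesianCode {F : Type*} [Field F] {n : ℕ} (K : Fin n → Finset F)
    (d : ℕ) : Submodule F (↥(Fintype.piFinset K) → F) :=
  (MvPolynomial.restrictTotalDegree (Fin n) F d).map (evalPoints K)

/-- The space of polynomials `f` of total degree at most `d` with
`deg_{X_s} f < |K_s| - δ + 1`, together with the zero polynomial. -/
noncomputable def quasiPolynomials {F : Type*} [Field F] {n : ℕ} (K : Fin n → Finset F)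
    (δ : ℕ) (s : Fin n) (d : ℕ) : Submodule F (MvPolynomial (Fin n) F) where
  carrier := {f | f.totalDegree ≤ d ∧
    (f = 0 ∨ (f.degreeOf s : ℤ) < ((K s).card : ℤ) - (δ : ℤ) + 1)}
  zero_mem' := ⟨by simp, Or.inl rfl⟩
  add_mem' := by
    rintro f g ⟨hf, hf'⟩ ⟨hg, hg'⟩
    refine ⟨(MvPolynomial.totalDegree_add f g).trans (max_le hf hg), ?_⟩
    rcases hf' with rfl | hf'
    · simpa using hg'
    rcases hg' with rfl | hg'
    · simpa using Or.inr hf'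
    right
    have h := MvPolynomial.degreeOf_add_le s f g
    rcases le_max_iff.1 h with h | h <;> omega
  smul_mem' := by
    rintro c f ⟨hf, hf'⟩
    refine ⟨(MvPolynomial.totalDegree_smul_le c f).trans hf, ?_⟩
    rcases hf' with rfl | hf'
    · left; simp
    right
    have h : (c • f).degreeOf s ≤ f.degreeOf s := by
      rw [MvPolynomial.smul_eq_C_mul]
      exact MvPolynomial.degreeOf_C_mul_le f s c
    omega

/-- The `(δ, s)`-quasi affine cartesian code of order `d`. -/
noncomputable def quasiAffineCartesianCode {F : Type*} [Field F] {n : ℕ} (K : Fin n → Finset F)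
    (δ : ℕ) (s : Fin n) (d : ℕ) : Submodule F (↥(Fintype.piFinset K) → F) :=
  (quasiPolynomials K δ s d).map (evalPoints K)

/-!
Modulo the polynomials vanishing on the grid, a nonzero codeword comes from a polynomial `g` with
`deg_{X_i} g < |K_i|`, and some monomial `m` of such a `g` satisfies `∏ (|K_i| - m_i) ≤ #{g ≠ 0}`.
Under the degree bound `d` the product is smallest when the degree is spent greedily on the smallest
sets `K_i`, which bounds the distance of the affine cartesian code from below. In cases (i) and (ii)
the weight `δ ≤ |K_s| - m_s` required of a quasi code can be arranged by swapping two of the greedy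
weights, and a product of linear factors with the swapped weights attains the bound.

The upper bound is the Singleton bound for locally recoverable codes. The repair groups are the
lines in the direction of the coordinate `s`: a codeword vanishing at `r` points of such a line
comes from a polynomial of degree less than `r` on it, hence vanishes on the whole line.
-/

open Finset MvPolynomial

section GridCount

variable {R : Type*} [CommRing R] [IsDomain R] [DecidableEq R]

theorem card_sub_natDegree_le_card_eval_ne_zero {p : Polynomial R} (hp : p ≠ 0) (S : Finset R) :
    #S - p.natDegree ≤ #{c ∈ S | p.eval c ≠ 0} := by
  have hroots : #{c ∈ S | p.eval c = 0} ≤ p.natDegree :=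
    calc #{c ∈ S | p.eval c = 0} ≤ #p.roots.toFinset :=
          card_le_card fun c hc => by simpa [hp] using (mem_filter.1 hc).2
      _ ≤ Multiset.card p.roots := p.roots.toFinset_card_le
      _ ≤ p.natDegree := p.card_roots'
  have hsplit : #{c ∈ S | p.eval c = 0} + #{c ∈ S | p.eval c ≠ 0} = #S :=
    card_filter_add_card_filter_not _
  omega

theorem card_filter_piFinset_succ {α : Type*} {n : ℕ} (S : Fin (n + 1) → Finset α)
    (P : (Fin (n + 1) → α) → Prop) [DecidablePred P] :
    #{x ∈ Fintype.piFinset S | P x} =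
      ∑ y ∈ Fintype.piFinset (Fin.tail S), #{c ∈ S 0 | P (Fin.cons c y)} := by
  have hgrid := filter_piFinset_eq_map_consEquiv S fun _ => True
  simp only [filter_true] at hgrid
  simp only [card_filter, hgrid, sum_map, sum_product_right]
  rfl

theorem exists_mem_support_prod_le_card_eval_ne_zero {n : ℕ} (S : Fin n → Finset R)
    {f : MvPolynomial (Fin n) R} (hf : f ≠ 0) :
    ∃ m ∈ f.support, ∏ i, (#(S i) - m i) ≤ #{a ∈ Fintype.piFinset S | eval a f ≠ 0} := by
  induction n with
  | zero =>
    obtain ⟨m, hm⟩ := support_nonempty.2 hf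
    rw [f.eq_C_of_isEmpty, C_ne_zero] at hf
    rw [f.eq_C_of_isEmpty] at hm ⊢
    exact ⟨m, hm, by simp [hf]⟩
  | succ n ih =>
    set p := finSuccEquiv R n f
    have hlead : p.leadingCoeff ≠ 0 :=
      Polynomial.leadingCoeff_ne_zero.2 (EmbeddingLike.map_ne_zero_iff.2 hf)
    obtain ⟨m, hm, hcount⟩ := ih (Fin.tail S) hlead
    refine ⟨m.cons p.natDegree, mem_support_coeff_finSuccEquiv.1 hm, ?_⟩
    have hfiber {y : Fin n → R} (hy : eval y p.leadingCoeff ≠ 0) :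
        #(S 0) - p.natDegree ≤ #{c ∈ S 0 | eval (Fin.cons c y) f ≠ 0} := by
      have hdeg := Polynomial.natDegree_map_of_leadingCoeff_ne_zero (eval y) hy
      have hpy : p.map (eval y) ≠ 0 := fun h => hy <| by
        rw [Polynomial.leadingCoeff, ← Polynomial.coeff_map, h, Polynomial.coeff_zero]
      simpa only [hdeg, eval_eq_eval_mv_eval'] using
        card_sub_natDegree_le_card_eval_ne_zero hpy (S 0)
    calc ∏ i, (#(S i) - m.cons p.natDegree i)
        = (∏ i, (#(Fin.tail S i) - m i)) * (#(S 0) - p.natDegree) := by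
          simp [Fin.prod_univ_succ, Fin.tail, mul_comm]
      _ ≤ #{y ∈ Fintype.piFinset (Fin.tail S) | eval y p.leadingCoeff ≠ 0} *
            (#(S 0) - p.natDegree) := Nat.mul_le_mul_right _ hcount
      _ ≤ ∑ y ∈ Fintype.piFinset (Fin.tail S) with eval y p.leadingCoeff ≠ 0,
            #{c ∈ S 0 | eval (Fin.cons c y) f ≠ 0} := by
          rw [← smul_eq_mul]
          exact card_nsmul_le_sum _ _ _ fun y hy => hfiber (mem_filter.1 hy).2
      _ ≤ ∑ y ∈ Fintype.piFinset (Fin.tail S), #{c ∈ S 0 | eval (Fin.cons c y) f ≠ 0} :=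
          sum_le_sum_of_subset (filter_subset _ _)
      _ = #{a ∈ Fintype.piFinset S | eval a f ≠ 0} :=
          (card_filter_piFinset_succ S fun a => eval a f ≠ 0).symm

end GridCount

section VanishingPoly

variable {R σ : Type*} [CommRing R]

/-- The monic polynomial in the single variable `X i` whose roots are the elements of `T`, seen as
a multivariate polynomial. -/
noncomputable def vanishingPoly (T : Finset R) (i : σ) : MvPolynomial σ R :=
  ∏ c ∈ T, (X i - C c)

theorem eval_vanishingPoly (T : Finset R) (i : σ) (a : σ → R) :
    eval a (vanishingPoly T i) = ∏ c ∈ T, (a i - c) := by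
  simp [vanishingPoly]

theorem monic_vanishingPoly (ord : MonomialOrder σ) (T : Finset R) (i : σ) :
    ord.Monic (vanishingPoly T i) :=
  MonomialOrder.Monic.prod fun c _ => ord.monic_X_sub_C i c

variable [Nontrivial R]

theorem totalDegree_vanishingPoly_le (T : Finset R) (i : σ) :
    (vanishingPoly T i).totalDegree ≤ #T := by
  refine (totalDegree_finsetProd _ _).trans ?_
  rw [card_eq_sum_ones]
  exact sum_le_sum fun c _ => (totalDegree_sub_C_le _ _).trans (totalDegree_X i).le

theorem degreeOf_vanishingPoly_le [DecidableEq σ] (T : Finset R) (i j : σ) :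
    (vanishingPoly T i).degreeOf j ≤ if j = i then #T else 0 :=
  calc (vanishingPoly T i).degreeOf j
      ≤ ∑ c ∈ T, (X i - C c : MvPolynomial σ R).degreeOf j := degreeOf_prod_le _ _ _
    _ ≤ ∑ c ∈ T, if j = i then 1 else 0 := sum_le_sum fun c _ => by
        simpa [degreeOf_X] using degreeOf_sub_le j (X i) (C c)
    _ = if j = i then #T else 0 := by simp

theorem degree_vanishingPoly (ord : MonomialOrder σ) (T : Finset R) (i : σ) :
    ord.degree (vanishingPoly T i) = Finsupp.single i #T := by
  rw [vanishingPoly, MonomialOrder.degree_prod_of_regular]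
  · simp [ord.degree_X_sub_C]
  · intro c _
    rw [ord.monic_X_sub_C]
    exact isRegular_one

open MonomialOrder in
theorem exists_degreeOf_lt_card_eval_eq [Finite σ] {S : σ → Finset R}
    (hS : ∀ i, (S i).Nonempty) (f : MvPolynomial σ R) :
    ∃ g : MvPolynomial σ R, g.totalDegree ≤ f.totalDegree ∧ (∀ i, g.degreeOf i < #(S i)) ∧
      ∀ a, (∀ i, a i ∈ S i) → eval a g = eval a f := by
  let : LinearOrder σ := WellOrderingRel.isWellOrder.linearOrder
  obtain ⟨h, g, hf, hh, hg⟩ := degLex.div (b := fun i => vanishingPoly (S i) i)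
    (fun i => by simp [(monic_vanishingPoly degLex (S i) i).leadingCoeff_eq_one]) f
  rw [Finsupp.linearCombination_apply] at hf
  refine ⟨g, ?_, fun i => ?_, fun a ha => ?_⟩
  · rw [← sub_eq_of_eq_add' hf]
    refine (totalDegree_sub _ _).trans (max_le le_rfl (totalDegree_finsetSum_le fun i _ => ?_))
    simp only [smul_eq_mul]
    rw [mul_comm]
    exact degLex_totalDegree_monotone (hh i)
  · rw [degreeOf_eq_sup, Finset.sup_lt_iff (hS i).card_pos]
    intro m hm
    simpa [degree_vanishingPoly, Finsupp.single_le_iff] using hg m hm i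
  · have hzero (i : σ) : eval a (vanishingPoly (S i) i) = 0 := by
      rw [eval_vanishingPoly, prod_eq_zero (ha i) (sub_self _)]
    rw [hf, map_add, map_finsuppSum, Finsupp.sum]
    simp [hzero]

end VanishingPoly

section GreedyWeights

variable {n : ℕ}

theorem mul_le_mul_of_add_eq_add {a b x y : ℕ} (h : a + b = x + y) (hax : a ≤ x) (hxb : x ≤ b) :
    a * b ≤ x * y := by
  obtain ⟨u, rfl⟩ := Nat.exists_eq_add_of_le hax
  obtain ⟨w, rfl⟩ := Nat.exists_eq_add_of_le hxb
  obtain rfl : y = a + w := by omega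
  nlinarith [Nat.zero_le (u * w)]

@[to_additive]
theorem prod_eq_prod_Iio_mul_mul_prod_Ioi {α M : Type*} [Fintype α] [LinearOrder α]
    [LocallyFiniteOrderTop α] [LocallyFiniteOrderBot α] [CommMonoid M] (f : α → M) (a : α) :
    ∏ i, f i = (∏ i ∈ Iio a, f i) * f a * ∏ i ∈ Ioi a, f i := by
  rw [Fintype.prod_eq_mul_prod_compl a, ← Ioi_disjUnion_Iio, prod_disjUnion, mul_comm (f a),
    mul_comm (∏ i ∈ Ioi a, f i), mul_right_comm]

theorem Ioi_castSucc_eq_Ici_succ (k : Fin n) : Ioi k.castSucc = Ici k.succ := by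
  ext i
  simp [Fin.castSucc_lt_iff_succ_le]

theorem mul_prod_Ioi_le_prod {c x : Fin n → ℕ} (hc : Monotone c) (hx : ∀ i, 1 ≤ x i)
    (hxc : ∀ i, x i ≤ c i) {k : Fin n} {v : ℕ} (hv : 1 ≤ v) (hvk : v ≤ c k)
    (hsum : k + v + ∑ i ∈ Ioi k, c i ≤ ∑ i, x i) : v * ∏ i ∈ Ioi k, c i ≤ ∏ i, x i := by
  induction n generalizing v with
  | zero => exact k.elim0
  | succ n ih =>
    specialize @ih (Fin.tail c) (Fin.tail x) (hc.comp (Fin.strictMono_succ).monotone)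
      (fun i => hx i.succ) (fun i => hxc i.succ)
    simp only [Fin.tail] at ih
    rw [Fin.sum_univ_succ] at hsum
    rw [Fin.prod_univ_succ]
    obtain hvx | hxv := le_or_gt v (x 0)
    · obtain ⟨j, rfl⟩ | rfl := k.eq_castSucc_or_eq_last
      · rw [Ioi_castSucc_eq_Ici_succ, ← add_sum_Ioi_eq_sum_Ici, Fin.sum_Ioi_succ,
          Fin.val_castSucc] at hsum
        rw [Ioi_castSucc_eq_Ici_succ, ← mul_prod_Ioi_eq_prod_Ici, Fin.prod_Ioi_succ, ← mul_assoc]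
        have hxj : x 0 ≤ c j.succ := (hxc 0).trans (hc (Fin.zero_le _))
        calc v * c j.succ * ∏ i ∈ Ioi j, c i.succ
            ≤ x 0 * (v + c j.succ - x 0) * ∏ i ∈ Ioi j, c i.succ :=
              Nat.mul_le_mul_right _ (mul_le_mul_of_add_eq_add (by omega) hvx hxj)
          _ ≤ x 0 * ∏ i : Fin n, x i.succ := by
              rw [mul_assoc]
              exact Nat.mul_le_mul_left _ (ih (by omega) (by omega) (by omega))
      · have hIoi : Ioi (Fin.last n) = ∅ := Ioi_eq_empty.2 fun i _ => Fin.le_last i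
        rw [hIoi, prod_empty, mul_one]
        exact hvx.trans (Nat.le_mul_of_pos_right _ (prod_pos fun i _ => hx _))
    · obtain rfl | ⟨j, rfl⟩ := k.eq_zero_or_eq_succ
      · have hle : ∑ i : Fin n, x i.succ ≤ ∑ i : Fin n, c i.succ := sum_le_sum fun i _ => hxc _
        rw [Fin.sum_Ioi_zero, Fin.val_zero] at hsum
        omega
      · rw [Fin.sum_Ioi_succ, Fin.val_succ] at hsum
        rw [Fin.prod_Ioi_succ]
        have hx0 := hx 0
        calc v * ∏ i ∈ Ioi j, c i.succ
            ≤ x 0 * (v + 1 - x 0) * ∏ i ∈ Ioi j, c i.succ := by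
              refine Nat.mul_le_mul_right _ ?_
              simpa only [one_mul] using
                mul_le_mul_of_add_eq_add (a := 1) (b := v) (by omega) hx0 hxv.le
          _ ≤ x 0 * ∏ i : Fin n, x i.succ := by
              rw [mul_assoc]
              exact Nat.mul_le_mul_left _ (ih (by omega) (by omega) (by omega))

/-- The weights `1, …, 1, v, c (k + 1), …, c (n - 1)`: those obtained from `c` by lowering the
entries to `1` from the left, until at the index `k` the entry is only lowered to `v`. -/
def greedyWeights (c : Fin n → ℕ) (k : Fin n) (v : ℕ) (i : Fin n) : ℕ :=
  if i < k then 1 else if i = k then v else c i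

variable {c : Fin n → ℕ} {k : Fin n} {v : ℕ}

theorem greedyWeights_of_lt {i : Fin n} (h : i < k) : greedyWeights c k v i = 1 :=
  if_pos h

theorem greedyWeights_self : greedyWeights c k v k = v := by
  simp [greedyWeights]

theorem greedyWeights_of_gt {i : Fin n} (h : k < i) : greedyWeights c k v i = c i := by
  simp [greedyWeights, h.not_gt, h.ne']

theorem one_le_greedyWeights (hc : ∀ i, 1 ≤ c i) (hv : 1 ≤ v) (i : Fin n) :
    1 ≤ greedyWeights c k v i := by
  unfold greedyWeights
  split_ifs
  exacts [le_rfl, hv, hc i]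

theorem greedyWeights_le (hc : ∀ i, 1 ≤ c i) (hv : v ≤ c k) (i : Fin n) :
    greedyWeights c k v i ≤ c i := by
  unfold greedyWeights
  split_ifs with _ hik
  exacts [hc i, hik ▸ hv, le_rfl]

theorem prod_greedyWeights : ∏ i, greedyWeights c k v i = v * ∏ i ∈ Ioi k, c i := by
  rw [prod_eq_prod_Iio_mul_mul_prod_Ioi _ k, greedyWeights_self,
    prod_eq_one fun i hi => greedyWeights_of_lt (mem_Iio.1 hi), one_mul,
    prod_congr rfl fun i hi => greedyWeights_of_gt (mem_Ioi.1 hi)]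

theorem sum_greedyWeights : ∑ i, greedyWeights c k v i = k + v + ∑ i ∈ Ioi k, c i := by
  rw [sum_eq_sum_Iio_add_add_sum_Ioi _ k, greedyWeights_self,
    sum_congr rfl fun i hi => greedyWeights_of_lt (mem_Iio.1 hi), ← card_eq_sum_ones, Fin.card_Iio,
    sum_congr rfl fun i hi => greedyWeights_of_gt (mem_Ioi.1 hi)]

theorem sum_sub_greedyWeights :
    ∑ i, (c i - greedyWeights c k v i) = ∑ i ∈ Iio k, (c i - 1) + (c k - v) := by
  have hlt (i : Fin n) (hi : i ∈ Iio k) : c i - greedyWeights c k v i = c i - 1 := by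
    rw [greedyWeights_of_lt (mem_Iio.1 hi)]
  have hgt (i : Fin n) (hi : i ∈ Ioi k) : c i - greedyWeights c k v i = 0 := by
    rw [greedyWeights_of_gt (mem_Ioi.1 hi), Nat.sub_self]
  rw [sum_eq_sum_Iio_add_add_sum_Ioi _ k, greedyWeights_self, sum_congr rfl hlt,
    sum_eq_zero hgt, add_zero]

theorem prod_greedyWeights_le_prod {x : Fin n → ℕ} (hc : Monotone c) (hx : ∀ i, 1 ≤ x i)
    (hxc : ∀ i, x i ≤ c i) (hv : 1 ≤ v) (hvk : v ≤ c k)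
    (hsum : ∑ i, (c i - x i) ≤ ∑ i, (c i - greedyWeights c k v i)) :
    ∏ i, greedyWeights c k v i ≤ ∏ i, x i := by
  have hle := greedyWeights_le (fun i => (hx i).trans (hxc i)) hvk
  rw [sum_tsub_distrib _ fun i _ => hxc i, sum_tsub_distrib _ fun i _ => hle i] at hsum
  have hx_le : ∑ i, x i ≤ ∑ i, c i := sum_le_sum fun i _ => hxc i
  have hg_le : ∑ i, greedyWeights c k v i ≤ ∑ i, c i := sum_le_sum fun i _ => hle i
  rw [prod_greedyWeights]
  exact mul_prod_Ioi_le_prod hc hx hxc hv hvk (by rw [← sum_greedyWeights]; omega)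

theorem exists_swap_greedyWeights_le {s : Fin n} {δ : ℕ} (hc : Monotone c) (hcpos : ∀ i, 1 ≤ c i)
    (hvk : v ≤ c k) (hδ : δ ≤ c s)
    (h : (∃ j, k < j ∧ c j ≤ c s) ∨ c s ≤ c k ∧ δ ≤ v ∧ v ≤ c s) :
    ∃ t, greedyWeights c k v t ≤ c s ∧ greedyWeights c k v s ≤ c t ∧ δ ≤ greedyWeights c k v t := by
  have hle := greedyWeights_le hcpos hvk
  obtain ⟨j, hkj, hjs⟩ | ⟨hsk, hδv, hvs⟩ := h
  · obtain hsj | hjs' := le_total s j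
    · refine ⟨j, ?_⟩
      rw [greedyWeights_of_gt hkj]
      exact ⟨hjs, (hle s).trans (hc hsj), hδ.trans (hc hsj)⟩
    · refine ⟨s, hle s, hle s, ?_⟩
      rwa [greedyWeights_of_gt (hkj.trans_le hjs')]
  · refine ⟨k, ?_⟩
    rw [greedyWeights_self]
    exact ⟨hvs, (hle s).trans hsk, hδv⟩

end GreedyWeights

section MinDistance

variable {F ι : Type*} [Field F] [DecidableEq F] [Fintype ι] {C D : Submodule F (ι → F)}

theorem minDistance_le_hammingNorm {z : ι → F} (hz : z ∈ C) (hz0 : z ≠ 0) :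
    minDistance C ≤ hammingNorm z :=
  Nat.sInf_le ⟨z, hz, 0, C.zero_mem, hz0, hammingDist_zero_right z⟩

theorem exists_hammingNorm_eq_minDistance (hC : C ≠ ⊥) :
    ∃ z ∈ C, z ≠ 0 ∧ hammingNorm z = minDistance C := by
  obtain ⟨z, hz, hz0⟩ := C.ne_bot_iff.1 hC
  obtain ⟨x, hx, y, hy, hxy, h⟩ := Nat.sInf_mem
    (s := {w : ℕ | ∃ x ∈ C, ∃ y ∈ C, x ≠ y ∧ hammingDist x y = w})
    ⟨_, z, hz, 0, C.zero_mem, hz0, rfl⟩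
  refine ⟨x - y, C.sub_mem hx hy, sub_ne_zero.2 hxy, ?_⟩
  rw [minDistance, ← h, hammingDist_comm, hammingDist_eq_hammingNorm, neg_add_eq_sub]

theorem minDistance_anti (hC : C ≠ ⊥) (hCD : C ≤ D) : minDistance D ≤ minDistance C := by
  obtain ⟨z, hz, hz0, hzmin⟩ := exists_hammingNorm_eq_minDistance hC
  exact hzmin ▸ minDistance_le_hammingNorm (hCD hz) hz0

end MinDistance

section CartesianCodes

variable {F : Type*} [Field F] {n : ℕ} {K : Fin n → Finset F}

theorem evalPoints_apply (f : MvPolynomial (Fin n) F) (a : ↥(Fintype.piFinset K)) :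
    evalPoints K f a = eval a.1 f := by
  simp [evalPoints, aeval_eq_eval]

theorem quasiAffineCartesianCode_le (δ : ℕ) (s : Fin n) (d : ℕ) :
    quasiAffineCartesianCode K δ s d ≤ affineCartesianCode K d :=
  Submodule.map_mono fun _ hf => (mem_restrictTotalDegree _ _ _).2 hf.1

theorem quasiAffineCartesianCode_ne_bot (hK : ∀ i, (K i).Nonempty) {δ : ℕ} {s : Fin n}
    (hδ : δ ≤ #(K s)) (d : ℕ) : quasiAffineCartesianCode K δ s d ≠ ⊥ := by
  choose a ha using hK
  refine (Submodule.ne_bot_iff _).2 ⟨evalPoints K 1, ⟨1, ⟨by simp, Or.inr ?_⟩, rfl⟩, fun h => ?_⟩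
  · rw [degreeOf_one]
    omega
  · simpa [evalPoints_apply] using congrFun h ⟨a, Fintype.mem_piFinset.2 ha⟩

variable [DecidableEq F]

theorem hammingNorm_evalPoints (f : MvPolynomial (Fin n) F) :
    hammingNorm (evalPoints K f) = #{a ∈ Fintype.piFinset K | eval a f ≠ 0} := by
  simp only [hammingNorm, evalPoints_apply]
  rw [← card_map (Function.Embedding.subtype _)]
  congr 1
  ext a
  simp [and_comm]

theorem prod_greedyWeights_le_minDistance (hK : ∀ i, (K i).Nonempty)
    (hmono : Monotone fun i => #(K i)) {k : Fin n} {v d : ℕ} (hv : 1 ≤ v) (hvk : v ≤ #(K k))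
    (hne : affineCartesianCode K d ≠ ⊥)
    (hd : d ≤ ∑ i, (#(K i) - greedyWeights (fun i => #(K i)) k v i)) :
    ∏ i, greedyWeights (fun i => #(K i)) k v i ≤ minDistance (affineCartesianCode K d) := by
  obtain ⟨_, ⟨f, hf, rfl⟩, hf0, hmin⟩ := exists_hammingNorm_eq_minDistance hne
  obtain ⟨g, hgf, hgK, hg⟩ := exists_degreeOf_lt_card_eval_eq hK f
  have hgz : evalPoints K g = evalPoints K f := funext fun a => by
    simpa only [evalPoints_apply] using hg a.1 (Fintype.mem_piFinset.1 a.2)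
  have hg0 : g ≠ 0 := fun h => hf0 (by rw [← hgz, h, map_zero])
  obtain ⟨m, hm, hcount⟩ := exists_mem_support_prod_le_card_eval_ne_zero K hg0
  have hmK (i : Fin n) : m i < #(K i) := (monomial_le_degreeOf i hm).trans_lt (hgK i)
  have hmd : ∑ i, m i ≤ d :=
    calc ∑ i, m i = m.sum fun _ e => e := by simp [Finsupp.sum_fintype]
      _ ≤ g.totalDegree := le_totalDegree hm
      _ ≤ d := hgf.trans ((mem_restrictTotalDegree _ _ _).1 hf)
  rw [← hmin, ← hgz, hammingNorm_evalPoints]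
  refine (prod_greedyWeights_le_prod hmono (fun i => ?_) (fun i => Nat.sub_le _ (m i)) hv hvk
    ?_).trans hcount
  · exact Nat.sub_pos_of_lt (hmK i)
  · simpa only [Nat.sub_sub_self (hmK _).le] using hmd.trans hd

theorem minDistance_quasiAffineCartesianCode_le_prod {x : Fin n → ℕ} (hx : ∀ i, 1 ≤ x i)
    (hxK : ∀ i, x i ≤ #(K i)) {s : Fin n} {δ d : ℕ} (hδ : δ ≤ x s)
    (hd : ∑ i, (#(K i) - x i) ≤ d) :
    minDistance (quasiAffineCartesianCode K δ s d) ≤ ∏ i, x i := by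
  choose T hTK hT using fun i => exists_subset_card_eq (Nat.sub_le #(K i) (x i))
  set f : MvPolynomial (Fin n) F := ∏ i, vanishingPoly (T i) i
  have hdeg : f.totalDegree ≤ d :=
    calc f.totalDegree ≤ ∑ i, (vanishingPoly (T i) i : MvPolynomial (Fin n) F).totalDegree :=
          totalDegree_finsetProd _ _
      _ ≤ ∑ i, #(T i) := sum_le_sum fun i _ => totalDegree_vanishingPoly_le _ i
      _ ≤ d := by simpa only [hT] using hd
  have hdegs : f.degreeOf s ≤ #(K s) - x s :=
    calc f.degreeOf s ≤ ∑ i, (vanishingPoly (T i) i : MvPolynomial (Fin n) F).degreeOf s :=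
          degreeOf_prod_le _ _ _
      _ ≤ ∑ i, if s = i then #(T i) else 0 :=
          sum_le_sum fun i _ => degreeOf_vanishingPoly_le _ i s
      _ = #(K s) - x s := by rw [Fintype.sum_ite_eq, hT]
  have hnonzero : {a ∈ Fintype.piFinset K | eval a f ≠ 0} =
      Fintype.piFinset fun i => K i \ T i := by
    ext a
    simp only [f, mem_filter, Fintype.mem_piFinset, map_prod, eval_vanishingPoly, prod_ne_zero_iff,
      mem_univ, true_implies, sub_ne_zero, mem_sdiff, forall_and]
    exact and_congr_right fun _ => forall_congr' fun i =>
      ⟨fun h hi => h _ hi rfl, fun h c hc hac => h (hac ▸ hc)⟩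
  have hnorm : hammingNorm (evalPoints K f) = ∏ i, x i := by
    rw [hammingNorm_evalPoints, hnonzero, Fintype.card_piFinset]
    refine prod_congr rfl fun i _ => ?_
    rw [card_sdiff_of_subset (hTK i), hT, Nat.sub_sub_self (hxK i)]
  rw [← hnorm]
  refine minDistance_le_hammingNorm ⟨f, ⟨hdeg, Or.inr ?_⟩, rfl⟩ ?_
  · have := hxK s
    omega
  · rw [← hammingNorm_pos_iff, hnorm]
    exact prod_pos fun i _ => hx i

theorem minDistance_quasiAffineCartesianCode_le_prod_greedyWeights {k s : Fin n} {v δ d : ℕ}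
    (hK : ∀ i, (K i).Nonempty) (hmono : Monotone fun i => #(K i)) (hδ : δ ≤ #(K s)) (hv : 1 ≤ v)
    (hvk : v ≤ #(K k)) (hd : ∑ i, (#(K i) - greedyWeights (fun i => #(K i)) k v i) ≤ d)
    (h : (∃ j, k < j ∧ #(K j) ≤ #(K s)) ∨ #(K s) ≤ #(K k) ∧ δ ≤ v ∧ v ≤ #(K s)) :
    minDistance (quasiAffineCartesianCode K δ s d) ≤
      ∏ i, greedyWeights (fun i => #(K i)) k v i := by
  set c : Fin n → ℕ := fun i => #(K i)
  have hc (i : Fin n) : 1 ≤ c i := (hK i).card_pos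
  have hle := greedyWeights_le hc hvk
  obtain ⟨t, hts, hst, hδt⟩ := exists_swap_greedyWeights_le hmono hc hvk hδ h
  set x : Fin n → ℕ := greedyWeights c k v ∘ Equiv.swap s t with hx
  have hxs : x s = greedyWeights c k v t := by simp [hx]
  have hxc (i : Fin n) : x i ≤ c i := by
    obtain rfl | his := eq_or_ne i s
    · rwa [hxs]
    obtain rfl | hit := eq_or_ne i t
    · simpa [hx] using hst
    · simpa [hx, Equiv.swap_apply_of_ne_of_ne his hit] using hle i
  have hsum : ∑ i, (c i - x i) = ∑ i, (c i - greedyWeights c k v i) := by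
    rw [sum_tsub_distrib _ fun i _ => hxc i, sum_tsub_distrib _ fun i _ => hle i,
      ← Equiv.sum_comp (Equiv.swap s t) (greedyWeights c k v)]
    rfl
  rw [← Equiv.prod_comp (Equiv.swap s t) (greedyWeights c k v)]
  exact minDistance_quasiAffineCartesianCode_le_prod (x := x)
    (fun i => one_le_greedyWeights hc hv _) hxc (hδt.trans_eq hxs.symm) (hsum.trans_le hd)

theorem minDistance_quasiAffineCartesianCode_eq {k s : Fin n} {v δ d : ℕ}
    (hK : ∀ i, (K i).Nonempty) (hmono : Monotone fun i => #(K i)) (hδ : δ ≤ #(K s)) (hv : 1 ≤ v)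
    (hvk : v ≤ #(K k)) (hd : d = ∑ i, (#(K i) - greedyWeights (fun i => #(K i)) k v i))
    (h : (∃ j, k < j ∧ #(K j) ≤ #(K s)) ∨ #(K s) ≤ #(K k) ∧ δ ≤ v ∧ v ≤ #(K s)) :
    minDistance (quasiAffineCartesianCode K δ s d) = minDistance (affineCartesianCode K d) := by
  have hQ := quasiAffineCartesianCode_ne_bot hK hδ d
  have hQC := quasiAffineCartesianCode_le (K := K) δ s d
  refine le_antisymm ?_ (minDistance_anti hQ hQC)
  calc minDistance (quasiAffineCartesianCode K δ s d)
      ≤ ∏ i, greedyWeights (fun i => #(K i)) k v i :=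
        minDistance_quasiAffineCartesianCode_le_prod_greedyWeights hK hmono hδ hv hvk hd.ge h
    _ ≤ minDistance (affineCartesianCode K d) :=
        prod_greedyWeights_le_minDistance hK hmono hv hvk (ne_bot_of_le_ne_bot hQ hQC) hd.le

end CartesianCodes

section LocallyRecoverable

variable {F ι : Type*} [Field F]

theorem exists_mem_ne_zero_forall_eq_zero [Finite ι] {C : Submodule F (ι → F)} {P : Finset ι}
    (hP : #P < Module.finrank F C) : ∃ z ∈ C, z ≠ 0 ∧ ∀ i ∈ P, z i = 0 := by
  let L : C →ₗ[F] (P → F) := (LinearMap.funLeft F F (Subtype.val : P → ι)).comp C.subtype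
  have hker : LinearMap.ker L ≠ ⊥ :=
    LinearMap.ker_ne_bot_of_finrank_lt (by simpa using hP)
  obtain ⟨z, hz, hz0⟩ := (LinearMap.ker L).ne_bot_iff.1 hker
  exact ⟨z, z.2, fun h => hz0 (Subtype.ext h),
    fun i hi => congrFun (LinearMap.mem_ker.1 hz) ⟨i, hi⟩⟩

variable [DecidableEq F] [Fintype ι] {C : Submodule F (ι → F)}

theorem minDistance_add_card_add_finrank_le {T U : Finset ι}
    (hT : #T < Module.finrank F C) (hTU : ∀ z ∈ C, (∀ i ∈ T, z i = 0) → ∀ i ∈ U, z i = 0) :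
    minDistance C + #U + Module.finrank F C ≤ Fintype.card ι + #T + 1 := by
  classical
  have hcompl : Module.finrank F C - 1 - #T ≤ #Uᶜ := by
    by_contra! hlt
    obtain ⟨z, hz, hz0, hzero⟩ := exists_mem_ne_zero_forall_eq_zero (C := C) (P := T ∪ Uᶜ)
      ((card_union_le _ _).trans_lt (by omega))
    refine hz0 (funext fun i => ?_)
    by_cases hi : i ∈ U
    · exact hTU z hz (fun i hi => hzero i (mem_union_left _ hi)) i hi
    · exact hzero i (mem_union_right _ (mem_compl.2 hi))
  obtain ⟨T', hT'U, hT'⟩ := exists_subset_card_eq hcompl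
  obtain ⟨z, hz, hz0, hzero⟩ := exists_mem_ne_zero_forall_eq_zero (C := C) (P := T ∪ T')
    ((card_union_le _ _).trans_lt (by omega))
  have hzU := hTU z hz fun i hi => hzero i (mem_union_left _ hi)
  have hnorm : hammingNorm z ≤ #(U ∪ T')ᶜ := card_le_card fun i hi => by
    rw [mem_compl, mem_union, not_or]
    exact ⟨fun h => (mem_filter.1 hi).2 (hzU i h),
      fun h => (mem_filter.1 hi).2 (hzero i (mem_union_right _ h))⟩
  have hdisj : Disjoint U T' := (subset_compl_iff_disjoint_left).1 hT'U
  have hmin := minDistance_le_hammingNorm hz hz0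
  have hcard := card_add_card_compl (U ∪ T')
  rw [card_union_of_disjoint hdisj] at hcard
  omega

theorem minDistance_add_finrank_add_div_mul_le {α β : Type*} [Fintype α] [Finite β]
    (e : ι ≃ α × β) {r : ℕ} (hr : 0 < r) (hrα : r ≤ Fintype.card α) (hC : C ≠ ⊥)
    (hloc : ∀ z ∈ C, ∀ b, r ≤ #{a | z (e.symm (a, b)) = 0} → ∀ a, z (e.symm (a, b)) = 0) :
    minDistance C + Module.finrank F C +
        (Module.finrank F C - 1) / r * (Fintype.card α - r) ≤ Fintype.card ι + 1 := by
  classical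
  have := Fintype.ofFinite β
  set κ := Module.finrank F C
  have hκ : 0 < κ := Module.finrank_pos_iff.2 (Submodule.nontrivial_iff_ne_bot.2 hC)
  obtain ⟨S, -, hS⟩ := exists_subset_card_eq (s := (univ : Finset α)) (n := r) (by simpa)
  let grid (S : Finset α) (B : Finset β) : Finset ι := (S ×ˢ B).map e.symm.toEmbedding
  have card_grid (S : Finset α) (B : Finset β) : #(grid S B) = #S * #B := by
    rw [card_map, card_product]
  have hspread (B : Finset β) (z : ι → F) (hz : z ∈ C) (hzero : ∀ i ∈ grid S B, z i = 0) :
      ∀ i ∈ grid univ B, z i = 0 := by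
    have hzS (a : α) (ha : a ∈ S) (b : β) (hb : b ∈ B) : z (e.symm (a, b)) = 0 :=
      hzero _ (mem_map_of_mem _ (mk_mem_product ha hb))
    simp only [grid, mem_map, mem_product]
    rintro _ ⟨⟨a, b⟩, ⟨-, hb⟩, rfl⟩
    refine hloc z hz b (hS ▸ card_le_card fun a ha => ?_) a
    exact mem_filter.2 ⟨mem_univ _, hzS a ha b hb⟩
  have hcardβ : (κ - 1) / r ≤ #(univ : Finset β) := by
    by_contra! hlt
    have hT : #(grid S univ) < κ := by
      have := (Nat.le_div_iff_mul_le hr).1 hlt.le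
      rw [card_grid, hS, mul_comm]
      omega
    obtain ⟨z, hz, hz0, hzero⟩ := exists_mem_ne_zero_forall_eq_zero hT
    refine hz0 (funext fun i => hspread univ z hz hzero i ?_)
    simp [grid]
  obtain ⟨B, -, hB⟩ := exists_subset_card_eq hcardβ
  have hT : #(grid S B) < κ := by
    have := Nat.mul_div_le (κ - 1) r
    rw [card_grid, hS, hB]
    omega
  have hsingleton := minDistance_add_card_add_finrank_le hT (hspread B)
  rw [card_grid, card_grid, hS, hB, card_univ] at hsingleton
  have hsplit : Fintype.card α * ((κ - 1) / r) =
      (κ - 1) / r * (Fintype.card α - r) + r * ((κ - 1) / r) := by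
    rw [mul_comm r, ← mul_add, Nat.sub_add_cancel hrα, mul_comm]
  omega

end LocallyRecoverable

section LineRestriction

variable {R σ : Type*} [CommSemiring R] [DecidableEq σ] (s : σ) (a : σ → R)

/-- The restriction of a multivariate polynomial to the line through `a` in the direction of the
coordinate `s`, as a univariate polynomial in the coordinate `s`. -/
noncomputable def lineRestriction : MvPolynomial σ R →ₐ[R] Polynomial R :=
  aeval (Function.update (fun i => Polynomial.C (a i)) s Polynomial.X)

theorem eval_lineRestriction (f : MvPolynomial σ R) (c : R) :
    (lineRestriction s a f).eval c = eval (Function.update a s c) f := by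
  have hcoord (i : σ) : Polynomial.aeval c
      (Function.update (fun i => Polynomial.C (a i)) s Polynomial.X i) =
        Function.update a s c i := by
    obtain rfl | hi := eq_or_ne i s
    · simp
    · simp [hi]
  rw [← Polynomial.coe_aeval_eq_eval, lineRestriction, comp_aeval_apply, funext hcoord,
    aeval_eq_eval]

theorem natDegree_lineRestriction_le (f : MvPolynomial σ R) :
    (lineRestriction s a f).natDegree ≤ f.degreeOf s := by
  have hcoord (i : σ) (e : ℕ) :
      (Function.update (fun i => Polynomial.C (a i)) s Polynomial.X i ^ e).natDegree ≤
        if i = s then e else 0 := by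
    obtain rfl | hi := eq_or_ne i s
    · simpa using Polynomial.natDegree_X_pow_le e
    · simpa [hi] using (Polynomial.natDegree_pow_le_of_le e (Polynomial.natDegree_C (a i)).le)
  rw [lineRestriction, aeval_def, eval₂_eq]
  refine Polynomial.natDegree_sum_le_of_forall_le _ _ fun m hm => ?_
  calc _ ≤ _ := Polynomial.natDegree_C_mul_le _ _
    _ ≤ ∑ i ∈ m.support, if i = s then m i else 0 :=
        (Polynomial.natDegree_prod_le _ _).trans (sum_le_sum fun i _ => hcoord i (m i))
    _ ≤ m s := by
        rw [sum_ite_eq']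
        split_ifs
        exacts [le_rfl, Nat.zero_le _]
    _ ≤ f.degreeOf s := monomial_le_degreeOf s hm

end LineRestriction

theorem ceil_natCast_div_natCast_sub_one {k : Type*} [Field k] [LinearOrder k]
    [IsStrictOrderedRing k] [FloorRing k] {a b : ℕ} (ha : 0 < a) (hb : 0 < b) :
    ⌈(a / b : k)⌉ - 1 = (((a - 1) / b : ℕ) : ℤ) := by
  have hlt : (a - 1) / b * b < a := (Nat.div_mul_le_self _ _).trans_lt (Nat.pred_lt ha.ne')
  have hle : a ≤ ((a - 1) / b + 1) * b :=
    Nat.le_of_pred_lt ((Nat.div_lt_iff_lt_mul hb).1 (Nat.lt_succ_self _))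
  have hb' : (0 : k) < b := Nat.cast_pos.2 hb
  rw [sub_eq_iff_eq_add, Int.ceil_eq_iff, Int.cast_add, Int.cast_one, Int.cast_natCast,
    add_sub_cancel_right, lt_div_iff₀ hb', div_le_iff₀ hb']
  exact ⟨mod_cast hlt, mod_cast hle⟩

section RepairGroups

variable {ι : Type*} [Fintype ι] [DecidableEq ι] {α : ι → Type*}

/-- The splitting of a grid into the lines in the direction of the coordinate `s`: a point of the
grid is sent to its coordinate at `s`, its position on the line, and to its other coordinates, which
determine the line. -/
def piFinsetEquivProd (K : ∀ i, Finset (α i)) (s : ι) :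
    ↥(Fintype.piFinset K) ≃ K s × ∀ j : {j // j ≠ s}, K j :=
  (Equiv.subtypeEquivRight fun _ => Fintype.mem_piFinset).trans <|
    Equiv.subtypePiEquivPi.trans <| Equiv.piSplitAt s fun i => K i

theorem piFinsetEquivProd_symm_eq_update {K : ∀ i, Finset (α i)} {s : ι} (c c' : K s)
    (y : ∀ j : {j // j ≠ s}, K j) : ((piFinsetEquivProd K s).symm (c', y)).1 =
      Function.update ((piFinsetEquivProd K s).symm (c, y)).1 s c' := by
  ext i
  obtain rfl | hi := eq_or_ne i s
  · simp [piFinsetEquivProd, Equiv.subtypePiEquivPi]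
  · simp [piFinsetEquivProd, Equiv.subtypePiEquivPi, hi]

variable {F : Type*} [Field F] [DecidableEq F] {n : ℕ} {K : Fin n → Finset F} {s : Fin n} {δ d : ℕ}

theorem quasiAffineCartesianCode_eq_zero_of_line {z : ↥(Fintype.piFinset K) → F}
    (hz : z ∈ quasiAffineCartesianCode K δ s d) (hδ : δ ≤ #(K s)) {y : ∀ j : {j // j ≠ s}, K j}
    (hy : #(K s) - δ + 1 ≤ #{c | z ((piFinsetEquivProd K s).symm (c, y)) = 0}) (c : K s) :
    z ((piFinsetEquivProd K s).symm (c, y)) = 0 := by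
  obtain ⟨f, ⟨-, rfl | hfs⟩, rfl⟩ := hz
  · simp
  set p := lineRestriction s ((piFinsetEquivProd K s).symm (c, y)).1 f
  have heval (c' : K s) :
      p.eval c'.1 = evalPoints K f ((piFinsetEquivProd K s).symm (c', y)) := by
    rw [eval_lineRestriction, ← piFinsetEquivProd_symm_eq_update, evalPoints_apply]
  have hdeg : p.natDegree ≤ f.degreeOf s := natDegree_lineRestriction_le _ _ f
  have hp : p = 0 := by
    refine p.eq_zero_of_natDegree_lt_card_of_eval_eq_zero'
      (map (Function.Embedding.subtype _)
        {c' | evalPoints K f ((piFinsetEquivProd K s).symm (c', y)) = 0}) ?_ ?_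
    · simp only [mem_map, mem_filter]
      rintro _ ⟨c', ⟨-, hc'⟩, rfl⟩
      exact (heval c').trans hc'
    · rw [card_map]
      omega
  rw [← heval, hp, Polynomial.eval_zero]

theorem minDistance_quasiAffineCartesianCode_add_finrank_le (hK : ∀ i, (K i).Nonempty)
    (hδ : 1 ≤ δ) (hδs : δ ≤ #(K s)) :
    minDistance (quasiAffineCartesianCode K δ s d) +
        Module.finrank F (quasiAffineCartesianCode K δ s d) +
        (Module.finrank F (quasiAffineCartesianCode K δ s d) - 1) / (#(K s) - δ + 1) * (δ - 1) ≤
      ∏ i, #(K i) + 1 := by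
  have hlrc := minDistance_add_finrank_add_div_mul_le (piFinsetEquivProd K s)
    (r := #(K s) - δ + 1) (Nat.add_one_pos _) (by rw [Fintype.card_coe]; omega)
    (quasiAffineCartesianCode_ne_bot hK hδs d)
    fun _ hz _ hy => quasiAffineCartesianCode_eq_zero_of_line hz hδs hy
  rw [Fintype.card_coe, Fintype.card_coe, Fintype.card_piFinset] at hlrc
  rwa [show δ - 1 = #(K s) - (#(K s) - δ + 1) by omega]

theorem minDistance_quasiAffineCartesianCode_le_sub_ceil (hK : ∀ i, (K i).Nonempty)
    (hδ : 1 ≤ δ) (hδs : δ ≤ #(K s)) {κ : ℕ}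
    (hκ : κ = Module.finrank F (quasiAffineCartesianCode K δ s d)) :
    (minDistance (quasiAffineCartesianCode K δ s d) : ℤ) ≤
      (∏ i, #(K i) : ℕ) - κ - (⌈(κ : ℝ) / (#(K s) - δ + 1 : ℕ)⌉ - 1) * ((δ : ℤ) - 1) + 1 := by
  have hκ0 : 0 < κ := hκ ▸ Module.finrank_pos_iff.2
    (Submodule.nontrivial_iff_ne_bot.2 (quasiAffineCartesianCode_ne_bot hK hδs d))
  have hadd := minDistance_quasiAffineCartesianCode_add_finrank_le (d := d) hK hδ hδs
  rw [← hκ] at hadd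
  rw [ceil_natCast_div_natCast_sub_one hκ0 (Nat.add_one_pos _), ← Nat.cast_pred hδ,
    ← Nat.cast_mul]
  omega

end RepairGroups

theorem theorem4p1_general {F : Type*} [Field F] [DecidableEq F] {n : ℕ}
    (K : Fin n → Finset F) (hK : ∀ i, (K i).Nonempty)
    (hmono : ∀ i j : Fin n, i ≤ j → (K i).card ≤ (K j).card)
    (s : Fin n) (δ r : ℕ) (hδ : 1 ≤ δ) (hδs : δ ≤ (K s).card) (hr : r = (K s).card - δ + 1)
    (d k l m κ : ℕ) (hk : k < n) (hl : l ≤ (K ⟨k, hk⟩).card - 1)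
    (hd : d = (∑ i : Fin n with i.val < k, ((K i).card - 1)) + l)
    (hm : m = ∏ i : Fin n, (K i).card)
    (hκ : κ = Module.finrank F (quasiAffineCartesianCode K δ s d)) :
    (minDistance (affineCartesianCode K d) ≤ minDistance (quasiAffineCartesianCode K δ s d) ∧
      (minDistance (quasiAffineCartesianCode K δ s d) : ℤ) ≤
        (m : ℤ) - κ - (⌈(κ : ℝ) / (r : ℝ)⌉ - 1) * ((δ : ℤ) - 1) + 1) ∧
    (((∃ hk2 : k + 1 < n, (K ⟨k + 1, hk2⟩).card ≤ (K s).card) ∨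
        ((K s).card ≤ (K ⟨k, hk⟩).card ∧
          0 ≤ ((K s).card : ℤ) - (((K ⟨k, hk⟩).card : ℤ) - l) ∧
          ((K s).card : ℤ) - (((K ⟨k, hk⟩).card : ℤ) - l) < r)) →
      minDistance (quasiAffineCartesianCode K δ s d) =
        minDistance (affineCartesianCode K d)) := by
  subst hr hm
  refine ⟨⟨minDistance_anti (quasiAffineCartesianCode_ne_bot hK hδs d)
    (quasiAffineCartesianCode_le δ s d),
    minDistance_quasiAffineCartesianCode_le_sub_ceil hK hδ hδs hκ⟩, fun hcase => ?_⟩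
  have hlk : l < #(K ⟨k, hk⟩) := Nat.lt_of_le_pred (hK _).card_pos hl
  set v := #(K ⟨k, hk⟩) - l with hv
  have hdeg : d = ∑ i, (#(K i) - greedyWeights (fun i => #(K i)) ⟨k, hk⟩ v i) := by
    rw [sum_sub_greedyWeights, hd, hv, Nat.sub_sub_self hlk.le, ← filter_gt_eq_Iio]
    rfl
  refine minDistance_quasiAffineCartesianCode_eq hK hmono hδs (Nat.sub_pos_of_lt hlk)
    (Nat.sub_le _ _) hdeg (hcase.imp ?_ ?_)
  · exact fun ⟨hk2, hks⟩ => ⟨⟨k + 1, hk2⟩, Nat.lt_succ_self k, hks⟩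
  · clear hcase
    rintro ⟨hsk, h0, hlt⟩
    exact ⟨hsk, by omega, by omega⟩

theorem theorem4p1 {F : Type*} [Field F] [Finite F] [DecidableEq F] {n : ℕ}
    (K : Fin n → Finset F) (hK : ∀ i, (K i).Nonempty)
    (hmono : ∀ i j : Fin n, i ≤ j → (K i).card ≤ (K j).card)
    (s : Fin n) (δ r : ℕ) (hδ : 2 ≤ δ) (hδs : δ ≤ (K s).card) (hr : r = (K s).card - δ + 1)
    (d k l m κ : ℕ) (hk : k < n) (hl0 : 0 < l) (hl : l ≤ (K ⟨k, hk⟩).card - 1)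
    (hd : d = (∑ i : Fin n with i.val < k, ((K i).card - 1)) + l)
    (hm : m = ∏ i : Fin n, (K i).card)
    (hκ : κ = Module.finrank F (quasiAffineCartesianCode K δ s d)) :
    (minDistance (affineCartesianCode K d) ≤ minDistance (quasiAffineCartesianCode K δ s d) ∧
      (minDistance (quasiAffineCartesianCode K δ s d) : ℤ) ≤
        (m : ℤ) - κ - (⌈(κ : ℝ) / (r : ℝ)⌉ - 1) * ((δ : ℤ) - 1) + 1) ∧
    (((∃ hk2 : k + 1 < n, (K ⟨k + 1, hk2⟩).card ≤ (K s).card) ∨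
        ((K s).card ≤ (K ⟨k, hk⟩).card ∧
          0 ≤ ((K s).card : ℤ) - (((K ⟨k, hk⟩).card : ℤ) - l) ∧
          ((K s).card : ℤ) - (((K ⟨k, hk⟩).card : ℤ) - l) < r)) →
      minDistance (quasiAffineCartesianCode K δ s d) =
        minDistance (affineCartesianCode K d)) :=
  theorem4p1_general K hK hmono s δ r (by omega) hδs hr d k l m κ hk hl hd hm hκ
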